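/- Let $\mathcal S=\{S_1,\dots,S_m\}$ be a finite family of contracting similitudes of $\mathbb R^n$ with ratios $c_i\in(0,1)$, i.e. $|S_i(x)-S_i(y)|=c_i|x-y|$ for all $x,y$, and let $E$ be its nonempty compact invariant set, $E=\bigcup_{i=1}^m S_i(E)$. For a finite word $\mathbf i=i_1\cdots i_k$ over $\{1,\dots,m\}$ put $S_{\mathbf i}=S_{i_1}\circ\cdots\circ S_{i_k}$ and $c_{\mathbf i}=c_{i_1}\cdots c_{i_k}$; for the empty word $\mathbf 0$, $S_{\mathbf 0}=\mathrm{id}$ and $c_{\mathbf 0}=1$. Write $\mathbf i|_k$ for the initial word of length $k$ of $\mathbf i$. For nonempty compact $A,B\subset\mathbb R^n$ let $\tilde h(A,B)$ be the infimum of the Hausdorff distances between $\varphi(A)$ and $\psi(B)$ over all isometries $\varphi,\psi$ of $\mathbb R^n$, let $d(A,B)=\inf\{|a-b|:a\in A,\,b\in B\}$, and let $r(A)=\inf_{x\in\mathbb R^n}\sup_{a\in A}|x-a|$. Let $\{F_{\mathbf i}\}$ be a family of nonempty compact subsets of $\mathbb R^n$ indexed by the finite words such that $F_{\mathbf i}=\bigcup_{i=1}^m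 F_{\mathbf i i}$ for every $\mathbf i$, and let $F=F_{\mathbf 0}$. Suppose that $F$ is a $\delta$-quasi-self-similar set with respect to $\mathcal S$: there are numbers $\delta_{\mathbf i}\ge 0$ with $\sup_{\mathbf i}\delta_{\mathbf i}=\delta<\infty$ and $$\tilde h\bigl(F_{\mathbf i},S_{\mathbf i}(E)\bigr)\le \delta_{\mathbf i}\,c_{\mathbf i}\,r(E)\quad\text{for every finite word }\mathbf i .$$ Suppose also that there is $\varepsilon_0>0$ such that $$d(F_{\mathbf i},F_{\mathbf j})\ge \varepsilon_0\,c_{\mathbf i|_k}$$ for all finite words $\mathbf i,\mathbf j$ and integers $k\ge 0$ with $\mathbf i|_k=\mathbf j|_k$ and $i_{k+1}\ne j_{k+1}$. Then the open set condition holds: there are open sets $V_{\mathbf i}$ and constants $a_1,a_2>0$ such that, for all finite words, $F_{\mathbf i}\subseteq \overline{V_{\mathbf i}}$; $V_{\mathbf i}\cap V_{\mathbf j}=\emptyset$ whenever no infinite word extends both $\mathbf i$ and $\mathbf j$; and $V_{\mathbf i}$ contains a ball of radius $a_1c_{\mathbf i}$ and is contained in a ball of radius $a_2c_{\mathbf i}$.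 Moreover the equation $\sum_{i=1}^m c_i^s=1$ has a unique real solution $s$ (the similarity dimension of $\mathcal S$), the box dimension of $F$ exists, and $$\dim_H F=\dim_B F=s,\qquad 0<\mathcal H^s(F)<\infty .$$ -/

import Mathlib

open scoped MeasureTheory

namespace QuasiSelfSimilar

noncomputable section

/-- Euclidean space of dimension `n`. -/
abbrev Eucl (n : ℕ) : Type := EuclideanSpace ℝ (Fin n)

/-- The distance between two sets, `d(A, B) = inf {d(a, b) : a ∈ A, b ∈ B}`
(used for nonempty sets). -/
def setDist {n : ℕ} (A B : Set (Eucl n)) : ℝ :=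
  sInf (Set.image2 dist A B)

/-- The radius `r(A) = inf_x sup_{a ∈ A} d(x, a)` (used for nonempty bounded sets). -/
def radius {n : ℕ} (A : Set (Eucl n)) : ℝ :=
  ⨅ x : Eucl n, ⨆ a : A, dist x (a : Eucl n)

/-- The shape difference: the infimum of the Hausdorff distances between the images of `A` and `B`
under isometries of the space (used for nonempty bounded sets). -/
def shapeDiff {n : ℕ} (A B : Set (Eucl n)) : ℝ :=
  sInf {t : ℝ | ∃ φ ψ : Eucl n → Eucl n, Isometry φ ∧ Isometry ψ ∧
    t = Metric.hausdorffDist (φ '' A) (ψ '' B)}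

/-- An iterated function system of `m` contracting similitudes of `n`-dimensional Euclidean
space. -/
structure IFSS (n m : ℕ) where
  /-- the similitudes -/
  map : Fin m → Eucl n → Eucl n
  /-- their ratios -/
  ratio : Fin m → ℝ
  ratio_pos : ∀ i, 0 < ratio i
  ratio_lt_one : ∀ i, ratio i < 1
  dist_map : ∀ i x y, dist (map i x) (map i y) = ratio i * dist x y

/-- A finite word over the alphabet `Fin m`; `[]` is the empty word. -/
abbrev Word (m : ℕ) : Type := List (Fin m)

/-- The set of the infinite words that extend a given finite word. -/
def cylinder {m : ℕ} (w : Word m) : Set (ℕ → Fin m) :=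
  {α | ∀ (l : ℕ) (h : l < w.length), α l = w[l]}

/-- `S_w = S_{w₁} ∘ ⋯ ∘ S_{w_k}`; the empty word gives the identity. -/
def IFSS.wordMap {n m : ℕ} (S : IFSS n m) : Word m → Eucl n → Eucl n
  | [] => id
  | i :: w => S.map i ∘ S.wordMap w

/-- `c_w = c_{w₁} ⋯ c_{w_k}`; the empty word gives `1`. -/
def IFSS.wordRatio {n m : ℕ} (S : IFSS n m) (w : Word m) : ℝ :=
  (w.map S.ratio).prod

/-- `E` is the (nonempty) compact invariant set of the iterated function system. -/
structure IFSS.IsInvariantSet {n m : ℕ} (S : IFSS n m) (E : Set (Eucl n)) : Prop where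
  nonempty : E.Nonempty
  isCompact : IsCompact E
  invariant : (⋃ i, S.map i '' E) = E

/-- `s` is the similarity dimension: the unique solution of `∑ c_i ^ s = 1`. -/
def IFSS.IsSimilarityDimension {n m : ℕ} (S : IFSS n m) (s : ℝ) : Prop :=
  (∑ i, S.ratio i ^ s = 1) ∧ ∀ t : ℝ, ∑ i, S.ratio i ^ t = 1 → t = s

/-- A structure system of the set `F []`: nonempty compact sets indexed by the finite words, each
of which is the union of its successors. -/
structure IsStructureSystem {n m : ℕ} (F : Word m → Set (Eucl n)) : Prop where
  nonempty : ∀ w, (F w).Nonempty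
  isCompact : ∀ w, IsCompact (F w)
  eq_iUnion : ∀ w, F w = ⋃ i : Fin m, F (w ++ [i])

/-- With the structure system `F`, the set `F []` is a `δ`-quasi-self-similar set
(a `δ`-perturbation of the self-similar set `E`) with the iterated function system `S`. As `δ` is a
real number, the supremum of the family `Δ` is finite. -/
structure IsQuasiSelfSimilar {n m : ℕ} (S : IFSS n m) (E : Set (Eucl n))
    (F : Word m → Set (Eucl n)) (δ : ℝ) : Prop where
  invariantSet : S.IsInvariantSet E
  structureSystem : IsStructureSystem F
  exists_family : ∃ Δ : Word m → ℝ, (∀ w, 0 ≤ Δ w) ∧ IsLUB (Set.range Δ) δ ∧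
    ∀ w, shapeDiff (F w) (S.wordMap w '' E) ≤ Δ w * S.wordRatio w * radius E

/-- The open set condition for the structure system `F`. -/
def OpenSetCondition {n m : ℕ} (S : IFSS n m) (F : Word m → Set (Eucl n)) : Prop :=
  ∃ V : Word m → Set (Eucl n),
    (∀ w, IsOpen (V w)) ∧
    (∀ w, F w ⊆ closure (V w)) ∧
    (∀ v w, cylinder v ∩ cylinder w = ∅ → V v ∩ V w = ∅) ∧
    ∃ a₁ a₂ : ℝ, 0 < a₁ ∧ 0 < a₂ ∧ ∀ w,
      (∃ x, Metric.ball x (a₁ * S.wordRatio w) ⊆ V w) ∧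
      (∃ y, V w ⊆ Metric.ball y (a₂ * S.wordRatio w))

/-- The separation condition with constant `ε₀`: if the words `v` and `w` agree in their first `k`
letters and differ in the next one, then `d(F_v, F_w) ≥ ε₀ c_u`, where `u` is the common initial
word of length `k`. -/
def SeparationCondition {n m : ℕ} (S : IFSS n m) (F : Word m → Set (Eucl n)) (ε₀ : ℝ) : Prop :=
  ∀ (v w : Word m) (k : ℕ) (hv : k < v.length) (hw : k < w.length),
    v.take k = w.take k → v[k] ≠ w[k] →
      ε₀ * S.wordRatio (v.take k) ≤ setDist (F v) (F w)

/-- The smallest number of sets of diameter at most `r` that cover `A`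
(used for bounded `A` and `r > 0`). -/
def coverNumber {n : ℕ} (A : Set (Eucl n)) (r : ℝ) : ℕ :=
  sInf {N : ℕ | ∃ U : Fin N → Set (Eucl n),
    (∀ j, Metric.ediam (U j) ≤ ENNReal.ofReal r) ∧ A ⊆ ⋃ j, U j}

/-- The box dimension of `A` exists and equals `s`: the lower and the upper limit of
`log N(r) / (-log r)` as `r → 0⁺` are both equal to `s`. -/
def HasBoxDim {n : ℕ} (A : Set (Eucl n)) (s : ℝ) : Prop :=
  Filter.Tendsto (fun r : ℝ => Real.log (coverNumber A r) / (-Real.log r))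
    (nhdsWithin 0 (Set.Ioi 0)) (nhds s)

end

end QuasiSelfSimilar

namespace QuasiSelfSimilar

open MeasureTheory Filter Topology Set

/-! ### Ratios of words and the similarity dimension. -/

section Words

variable {n m : ℕ} (S : IFSS n m)

/-! Quasi-self-similarity is used only for a diameter bound: isometries preserve distances, so `F w`
has diameter at most a constant times `c_w` (`IsQuasiSelfSimilar.exists_dist_le`). This bound and
the separation then suffice, since `∑ c_i ^ s = 1` makes the weights `c_w ^ s` additive under
splitting a word.

Upper bound (`exists_cover`): split words until `c_w` drops to the order of `r`. The weights sum to
one and each is at least of order `r ^ s`, so `O(r ^ (-s))` pieces cover `F []`.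

Lower bound (`exists_massDistribution`): push the Bernoulli measure on infinite words to `F []`. If
a closed set contains points with distinct codes, all its codes lie in one cylinder, at whose next
letter two of them part; separation then bounds `ε₀ c_w` by its diameter, and so its mass by `(diam
/ ε₀) ^ s`.

The two bounds give the Hausdorff measure, both dimensions and the covering numbers. The open sets
are neighbourhoods of the `F w` of radius proportional to `c_w`. -/

theorem IFSS.wordRatio_nil : S.wordRatio [] = 1 := by simp [IFSS.wordRatio]

theorem IFSS.wordRatio_append (v w : Word m) :
    S.wordRatio (v ++ w) = S.wordRatio v * S.wordRatio w := by
  simp [IFSS.wordRatio]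

theorem IFSS.wordRatio_append_singleton (w : Word m) (i : Fin m) :
    S.wordRatio (w ++ [i]) = S.wordRatio w * S.ratio i := by
  simp [IFSS.wordRatio]

theorem IFSS.wordRatio_cons (i : Fin m) (w : Word m) :
    S.wordRatio (i :: w) = S.ratio i * S.wordRatio w := by
  simp [IFSS.wordRatio]

theorem IFSS.wordRatio_pos (w : Word m) : 0 < S.wordRatio w := by
  induction w with
  | nil => simp [S.wordRatio_nil]
  | cons i w ih => rw [S.wordRatio_cons]; exact mul_pos (S.ratio_pos i) ih

theorem IFSS.wordRatio_le_one (w : Word m) : S.wordRatio w ≤ 1 := by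
  induction w with
  | nil => simp [S.wordRatio_nil]
  | cons i w ih =>
    rw [S.wordRatio_cons]
    exact mul_le_one₀ (S.ratio_lt_one i).le (S.wordRatio_pos w).le ih

theorem IFSS.wordRatio_le_take (w : Word m) (k : ℕ) : S.wordRatio w ≤ S.wordRatio (w.take k) := by
  conv_lhs => rw [← List.take_append_drop k w, S.wordRatio_append]
  exact mul_le_of_le_one_right (S.wordRatio_pos _).le (S.wordRatio_le_one _)

theorem IFSS.wordRatio_le_pow {q : ℝ} (hq : ∀ i, S.ratio i ≤ q) (w : Word m) :
    S.wordRatio w ≤ q ^ w.length := by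
  induction w with
  | nil => simp [S.wordRatio_nil]
  | cons i w ih =>
    rw [S.wordRatio_cons, List.length_cons, pow_succ']
    exact mul_le_mul (hq i) ih (S.wordRatio_pos w).le ((S.ratio_pos i).le.trans (hq i))

theorem IFSS.dist_wordMap (w : Word m) (x y : Eucl n) :
    dist (S.wordMap w x) (S.wordMap w y) = S.wordRatio w * dist x y := by
  induction w with
  | nil => simp [S.wordRatio_nil, IFSS.wordMap]
  | cons i w ih =>
    simp only [IFSS.wordMap, Function.comp_apply]
    rw [S.dist_map, ih, S.wordRatio_cons, mul_assoc]

theorem IFSS.exists_ratio_le [NeZero m] : ∃ q : ℝ, 0 < q ∧ q < 1 ∧ ∀ i, S.ratio i ≤ q := by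
  obtain ⟨i, hi⟩ := Finite.exists_max S.ratio
  exact ⟨S.ratio i, S.ratio_pos i, S.ratio_lt_one i, hi⟩

theorem IFSS.exists_le_ratio [NeZero m] : ∃ p : ℝ, 0 < p ∧ p < 1 ∧ ∀ i, p ≤ S.ratio i := by
  obtain ⟨i, hi⟩ := Finite.exists_min S.ratio
  exact ⟨S.ratio i, S.ratio_pos i, S.ratio_lt_one i, hi⟩

/-- Words neither of which is an initial word of the other disagree at some letter after a common
initial word. -/
theorem exists_take_eq_getElem_ne [NeZero m] {v w : Word m}
    (h : cylinder v ∩ cylinder w = ∅) :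
    ∃ (k : ℕ) (hv : k < v.length) (hw : k < w.length), v.take k = w.take k ∧ v[k] ≠ w[k] := by
  classical
  have hex : ∃ k, ∃ (hv : k < v.length) (hw : k < w.length), v[k] ≠ w[k] := by
    by_contra! hcon
    -- With no disagreement, reading `v`, then the rest of `w`, then zeros extends both words.
    refine Set.eq_empty_iff_forall_notMem.1 h
      (fun l => if hl : l < v.length then v[l] else if hl' : l < w.length then w[l] else 0)
      ⟨fun l hl => by simp [hl], fun l hl => ?_⟩
    by_cases hlv : l < v.length
    · simp [hlv, hcon l hlv hl]
    · simp [hlv, hl]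
  obtain ⟨hv, hw, hne⟩ := Nat.find_spec hex
  refine ⟨Nat.find hex, hv, hw, ?_, hne⟩
  apply List.ext_getElem
  · simp [hv.le, hw.le]
  · intro l h1 h2
    simp only [List.length_take, lt_min_iff] at h1 h2
    have := Nat.find_min hex h1.1
    push Not at this
    simpa using this h1.2 h2.2

/-- The similarity dimension exists, and is nonnegative. -/
theorem IFSS.exists_isSimilarityDimension [NeZero m] :
    ∃ s : ℝ, 0 ≤ s ∧ S.IsSimilarityDimension s := by
  have hanti : StrictAnti fun t : ℝ => ∑ i, S.ratio i ^ t := fun a b hab =>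
    Finset.sum_lt_sum_of_nonempty Finset.univ_nonempty fun i _ =>
      Real.rpow_lt_rpow_of_exponent_gt (S.ratio_pos i) (S.ratio_lt_one i) hab
  have hcont : Continuous fun t : ℝ => ∑ i, S.ratio i ^ t :=
    continuous_finsetSum _ fun i _ => Real.continuous_const_rpow (S.ratio_pos i).ne'
  have hlim : Tendsto (fun t : ℝ => ∑ i, S.ratio i ^ t) atTop (𝓝 0) := by
    simpa using tendsto_finsetSum (Finset.univ : Finset (Fin m)) fun i _ =>
      tendsto_rpow_atTop_of_base_lt_one (S.ratio i)
        (by linarith [S.ratio_pos i]) (S.ratio_lt_one i)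
  have h0 : 1 ≤ ∑ i, S.ratio i ^ (0 : ℝ) := by
    simp only [Real.rpow_zero, Finset.sum_const, Finset.card_univ, Fintype.card_fin, nsmul_eq_mul,
      mul_one]
    exact_mod_cast NeZero.one_le
  obtain ⟨b, hb1, hb0⟩ :=
    ((hlim.eventually (gt_mem_nhds one_pos)).and (eventually_ge_atTop 0)).exists
  obtain ⟨s, hs, hs1⟩ := intermediate_value_Icc' hb0 hcont.continuousOn ⟨hb1.le, h0⟩
  exact ⟨s, hs.1, hs1, fun t ht => hanti.injective (ht.trans hs1.symm)⟩

end Words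

/-! ### Diameter bound and the open set condition. -/

section Separation

variable {n m : ℕ} {S : IFSS n m} {E : Set (Eucl n)} {F : Word m → Set (Eucl n)} {δ ε₀ : ℝ}

theorem setDist_le_dist {A B : Set (Eucl n)} {x y : Eucl n} (hx : x ∈ A) (hy : y ∈ B) :
    setDist A B ≤ dist x y :=
  csInf_le ⟨0, by rintro _ ⟨a, _, b, _, rfl⟩; exact dist_nonneg⟩ ⟨x, hx, y, hy, rfl⟩

theorem IsStructureSystem.neZero (hF : IsStructureSystem F) : NeZero m := by
  refine ⟨?_⟩
  rintro rfl
  obtain ⟨x, hx⟩ := hF.nonempty []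
  rw [hF.eq_iUnion] at hx
  simp at hx

theorem radius_nonneg (A : Set (Eucl n)) : 0 ≤ radius A :=
  Real.iInf_nonneg fun _ => Real.iSup_nonneg fun _ => dist_nonneg

/-- The diameters of the sets `F w` are comparable with the ratios of the words. -/
theorem IsQuasiSelfSimilar.exists_dist_le (hF : IsQuasiSelfSimilar S E F δ) :
    ∃ C : ℝ, 0 < C ∧ ∀ w, ∀ x ∈ F w, ∀ y ∈ F w, dist x y ≤ C * S.wordRatio w := by
  obtain ⟨Δ, h0, hΔ, hd⟩ := hF.exists_family
  have hδ : 0 ≤ δ := (h0 []).trans (hΔ.1 ⟨[], rfl⟩)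
  have hr := radius_nonneg E
  have hEb := hF.invariantSet.isCompact.isBounded
  have hdiam : 0 ≤ Metric.diam E := Metric.diam_nonneg
  -- The `+ 1` makes the bound on the infimum strict, so some pair of isometries attains it; the
  -- factor 2 pays for moving both points to the copy of `E`.
  refine ⟨Metric.diam E + 2 * (δ * radius E + 1), by positivity, fun w x hx y hy => ?_⟩
  have hc := S.wordRatio_pos w
  have hlt : shapeDiff (F w) (S.wordMap w '' E) < (δ * radius E + 1) * S.wordRatio w := by
    have h1 : Δ w ≤ δ := hΔ.1 ⟨w, rfl⟩
    have h2 : Δ w * S.wordRatio w * radius E ≤ δ * S.wordRatio w * radius E := by gcongr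
    linarith [hd w]
  obtain ⟨_, ⟨φ, ψ, hφ, hψ, rfl⟩, ht⟩ := exists_lt_of_csInf_lt
    (by exact ⟨_, id, id, isometry_id, isometry_id, rfl⟩) hlt
  have hwc : Continuous (S.wordMap w) := by
    refine (LipschitzWith.of_dist_le_mul (K := ⟨S.wordRatio w, hc.le⟩) fun a b => ?_).continuous
    exact (S.dist_wordMap w a b).le
  have hcp : IsCompact (ψ '' (S.wordMap w '' E)) :=
    (hF.invariantSet.isCompact.image hwc).image hψ.continuous
  have hne := Metric.hausdorffEDist_ne_top_of_nonempty_of_bounded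
    ((hF.structureSystem.nonempty w).image φ)
    ((hF.invariantSet.nonempty.image (S.wordMap w)).image ψ)
    ((hF.structureSystem.isCompact w).image hφ.continuous).isBounded hcp.isBounded
  obtain ⟨_, ⟨_, ⟨a, ha, rfl⟩, rfl⟩, hxa⟩ :=
    Metric.exists_dist_lt_of_hausdorffDist_lt (mem_image_of_mem φ hx) ht hne
  obtain ⟨_, ⟨_, ⟨b, hb, rfl⟩, rfl⟩, hyb⟩ :=
    Metric.exists_dist_lt_of_hausdorffDist_lt (mem_image_of_mem φ hy) ht hne
  have hab : dist (ψ (S.wordMap w a)) (ψ (S.wordMap w b)) ≤ S.wordRatio w * Metric.diam E := by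
    rw [hψ.dist_eq, S.dist_wordMap]
    gcongr
    exact Metric.dist_le_diam_of_mem hEb ha hb
  have htri := dist_triangle4_right (φ x) (φ y) (ψ (S.wordMap w a)) (ψ (S.wordMap w b))
  rw [hφ.dist_eq] at htri
  linarith

/-- Thickening by half the separation constant works: both radii are at most `ε₀ c_u / 2` for the
common initial word `u`, so a shared point would bring the two pieces closer than `ε₀ c_u`. -/
theorem SeparationCondition.openSetCondition (hsep : SeparationCondition S F ε₀) (hε : 0 < ε₀)
    (hF : IsStructureSystem F) {C : ℝ} (hC : 0 < C)
    (hdist : ∀ w, ∀ x ∈ F w, ∀ y ∈ F w, dist x y ≤ C * S.wordRatio w) :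
    OpenSetCondition S F := by
  have := hF.neZero
  refine ⟨fun w => Metric.thickening (ε₀ / 2 * S.wordRatio w) (F w),
    fun w => Metric.isOpen_thickening,
    fun w => (Metric.self_subset_thickening (by have := S.wordRatio_pos w; positivity) _).trans
      subset_closure,
    fun v w h => ?_, ε₀ / 2, C + ε₀ / 2, by positivity, by positivity, fun w => ?_⟩
  · obtain ⟨k, hv, hw, htake, hne⟩ := exists_take_eq_getElem_ne h
    refine Set.eq_empty_iff_forall_notMem.2 fun x ⟨hxv, hxw⟩ => ?_
    obtain ⟨a, ha, hxa⟩ := Metric.mem_thickening_iff.1 hxv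
    obtain ⟨b, hb, hxb⟩ := Metric.mem_thickening_iff.1 hxw
    have h1 := (hsep v w k hv hw htake hne).trans (setDist_le_dist ha hb)
    have h2 : ε₀ / 2 * S.wordRatio v ≤ ε₀ / 2 * S.wordRatio (v.take k) := by
      gcongr; exact S.wordRatio_le_take v k
    have h3 : ε₀ / 2 * S.wordRatio w ≤ ε₀ / 2 * S.wordRatio (v.take k) := by
      rw [htake]; gcongr; exact S.wordRatio_le_take w k
    linarith [dist_triangle_left a b x]
  · obtain ⟨x, hx⟩ := hF.nonempty w
    refine ⟨⟨x, Metric.ball_subset_thickening hx _⟩, x, fun y hy => ?_⟩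
    obtain ⟨z, hz, hyz⟩ := Metric.mem_thickening_iff.1 hy
    rw [Metric.mem_ball]
    linarith [dist_triangle y z x, hdist w z hz x hx]

end Separation

/-! ### Economical covers and finite Hausdorff measure. -/

section Covers

variable {n m : ℕ} {S : IFSS n m} {F : Word m → Set (Eucl n)} {s C p r : ℝ}

/-- Covering `F w` by the pieces whose diameter first drops to `r`. -/
theorem exists_cover_word (hF : IsStructureSystem F) (hs0 : 0 ≤ s)
    (hs : ∑ i, S.ratio i ^ s = 1)
    (hdist : ∀ w, ∀ x ∈ F w, ∀ y ∈ F w, dist x y ≤ C * S.wordRatio w)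
    {q ρ : ℝ} (hq : ∀ i, S.ratio i ≤ q) (hp0 : 0 < p) (hp : ∀ i, p ≤ S.ratio i)
    (hρ : 0 < ρ) (hC : 0 ≤ C) (k : ℕ) (w : Word m) (hw : ρ * p ≤ S.wordRatio w)
    (hk : S.wordRatio w * q ^ k ≤ ρ) :
    ∃ (ι : Type) (_ : Fintype ι) (U : ι → Set (Eucl n)),
      (∀ j, Metric.ediam (U j) ≤ ENNReal.ofReal (C * ρ)) ∧ F w ⊆ ⋃ j, U j ∧
      (Fintype.card ι : ℝ) ≤ (S.wordRatio w / (ρ * p)) ^ s := by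
  have hρp : 0 < ρ * p := mul_pos hρ hp0
  have base : ∀ w : Word m, ρ * p ≤ S.wordRatio w → S.wordRatio w ≤ ρ →
      ∃ (ι : Type) (_ : Fintype ι) (U : ι → Set (Eucl n)),
      (∀ j, Metric.ediam (U j) ≤ ENNReal.ofReal (C * ρ)) ∧ F w ⊆ ⋃ j, U j ∧
      (Fintype.card ι : ℝ) ≤ (S.wordRatio w / (ρ * p)) ^ s := by
    intro w hw hwρ
    refine ⟨Unit, inferInstance, fun _ => F w, fun _ => ?_, subset_iUnion (fun _ : Unit => F w) (),
      by simpa using Real.one_le_rpow ((one_le_div hρp).2 hw) hs0⟩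
    refine Metric.ediam_le fun x hx y hy => ?_
    rw [edist_dist]
    refine ENNReal.ofReal_le_ofReal ((hdist w x hx y hy).trans ?_)
    gcongr
  -- `k` bounds the splittings still needed. A word is split only while `c_w > ρ`, so its successors
  -- keep `c ≥ ρ p`.
  induction k generalizing w with
  | zero => exact base w hw (by simpa using hk)
  | succ k ih =>
    rcases le_or_gt (S.wordRatio w) ρ with hwρ | hwρ
    · exact base w hw hwρ
    have key : ∀ i : Fin m, ∃ (ι : Type) (_ : Fintype ι) (U : ι → Set (Eucl n)),
        (∀ j, Metric.ediam (U j) ≤ ENNReal.ofReal (C * ρ)) ∧ F (w ++ [i]) ⊆ ⋃ j, U j ∧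
        (Fintype.card ι : ℝ) ≤ (S.wordRatio (w ++ [i]) / (ρ * p)) ^ s := by
      intro i
      apply ih
      · rw [S.wordRatio_append_singleton]
        exact mul_le_mul hwρ.le (hp i) hp0.le (S.wordRatio_pos w).le
      · rw [S.wordRatio_append_singleton]
        refine le_trans ?_ hk
        have := S.wordRatio_pos w
        have hq0 : 0 ≤ q := (S.ratio_pos i).le.trans (hq i)
        rw [pow_succ', ← mul_assoc]
        gcongr
        exact hq i
    choose ι hι U hU hcov hcard using key
    refine ⟨Σ i, ι i, inferInstance, fun j => U j.1 j.2, fun j => hU _ _, ?_, ?_⟩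
    · rw [hF.eq_iUnion]
      refine iUnion_subset fun i x hx => ?_
      obtain ⟨j, hj⟩ := mem_iUnion.1 (hcov i hx)
      exact mem_iUnion.2 ⟨⟨i, j⟩, hj⟩
    · rw [Fintype.card_sigma, Nat.cast_sum]
      calc ∑ i, (Fintype.card (ι i) : ℝ)
          ≤ ∑ i, (S.wordRatio w / (ρ * p)) ^ s * S.ratio i ^ s := by
            refine Finset.sum_le_sum fun i _ => (hcard i).trans_eq ?_
            rw [S.wordRatio_append_singleton, mul_div_right_comm,
              Real.mul_rpow (div_nonneg (S.wordRatio_pos w).le hρp.le) (S.ratio_pos i).le]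
        _ = (S.wordRatio w / (ρ * p)) ^ s := by rw [← Finset.mul_sum, hs, mul_one]

/-- The set `F []` is covered by `O(r ^ (-s))` sets of diameter at most `r`. -/
theorem exists_cover (hF : IsStructureSystem F) (hs0 : 0 ≤ s)
    (hs : ∑ i, S.ratio i ^ s = 1) (hC : 0 < C)
    (hdist : ∀ w, ∀ x ∈ F w, ∀ y ∈ F w, dist x y ≤ C * S.wordRatio w) :
    ∃ K : ℝ, ∀ r, 0 < r → r < C → ∃ (N : ℕ) (U : Fin N → Set (Eucl n)),
      (∀ j, Metric.ediam (U j) ≤ ENNReal.ofReal r) ∧ F [] ⊆ ⋃ j, U j ∧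
      (N : ℝ) * r ^ s ≤ K := by
  have := hF.neZero
  obtain ⟨q, hq0, hq1, hq⟩ := S.exists_ratio_le
  obtain ⟨p, hp0, hp1, hp⟩ := S.exists_le_ratio
  refine ⟨(C / p) ^ s, fun r hr hrC => ?_⟩
  have hρ : 0 < r / C := by positivity
  have hρ1 : r / C < 1 := (div_lt_one hC).2 hrC
  obtain ⟨k, hk⟩ := exists_pow_lt_of_lt_one hρ hq1
  obtain ⟨ι, hι, U, hU, hcov, hcard⟩ := exists_cover_word hF hs0 hs hdist hq hp0 hp hρ hC.le k []
    (by rw [S.wordRatio_nil]; exact mul_le_one₀ hρ1.le hp0.le hp1.le)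
    (by rw [S.wordRatio_nil, one_mul]; exact hk.le)
  rw [mul_div_cancel₀ r hC.ne'] at hU
  refine ⟨Fintype.card ι, fun j => U ((Fintype.equivFin ι).symm j), fun j => hU _, ?_, ?_⟩
  · rwa [(Fintype.equivFin ι).symm.surjective.iUnion_comp U]
  · calc (Fintype.card ι : ℝ) * r ^ s ≤ (S.wordRatio [] / (r / C * p)) ^ s * r ^ s := by gcongr
      _ = (C / p) ^ s := by
        rw [S.wordRatio_nil, ← Real.mul_rpow (by positivity) hr.le]
        congr 1
        field_simp

/-- A set covered by `O(r ^ (-s))` sets of diameter at most `r` has finite `s`-dimensional Hausdorff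
measure. -/
theorem hausdorffMeasure_lt_top_of_cover {A : Set (Eucl n)} (hs0 : 0 ≤ s) {K : ℝ} (hC : 0 < C)
    (h : ∀ r, 0 < r → r < C → ∃ (N : ℕ) (U : Fin N → Set (Eucl n)),
      (∀ j, Metric.ediam (U j) ≤ ENNReal.ofReal r) ∧ A ⊆ ⋃ j, U j ∧ (N : ℝ) * r ^ s ≤ K) :
    μH[s] A < ⊤ := by
  obtain ⟨u, -, hu, hu0⟩ := exists_seq_strictAnti_tendsto' hC
  choose N U hU hcov hN using fun k => h (u k) (hu k).1 (hu k).2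
  have hr : Tendsto (fun k => ENNReal.ofReal (u k)) atTop (𝓝 0) := by
    simpa using ENNReal.tendsto_ofReal hu0
  refine (Measure.hausdorffMeasure_le_liminf_sum s A _ hr U (Eventually.of_forall hU)
    (Eventually.of_forall hcov)).trans_lt ?_
  refine lt_of_le_of_lt ?_ (ENNReal.ofReal_lt_top (r := K))
  refine (liminf_le_liminf (v := fun _ => ENNReal.ofReal K) (Eventually.of_forall fun k => ?_)).trans
    (liminf_const _).le
  calc ∑ i, Metric.ediam (U k i) ^ s ≤ ∑ _i : Fin (N k), ENNReal.ofReal (u k) ^ s := by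
        gcongr with i; exact hU k i
    _ = ENNReal.ofReal (N k * u k ^ s) := by
        rw [ENNReal.ofReal_mul (Nat.cast_nonneg _), ENNReal.ofReal_natCast,
          ENNReal.ofReal_rpow_of_nonneg (hu k).1.le hs0]
        simp
    _ ≤ ENNReal.ofReal K := ENNReal.ofReal_le_ofReal (hN k)

end Covers

/-! ### Infinite words and the mass distribution. -/

section Coding

variable {n m : ℕ} {S : IFSS n m} {F : Word m → Set (Eucl n)} {s C ε₀ : ℝ}

/-- The initial word of length `k` of an infinite word. -/
def initialWord (α : ℕ → Fin m) (k : ℕ) : Word m := (List.range k).map α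

theorem initialWord_succ (α : ℕ → Fin m) (k : ℕ) :
    initialWord α (k + 1) = initialWord α k ++ [α k] := by
  simp [initialWord, List.range_succ]

theorem length_initialWord (α : ℕ → Fin m) (k : ℕ) : (initialWord α k).length = k := by
  simp [initialWord]

theorem initialWord_congr {α β : ℕ → Fin m} {k : ℕ} (h : ∀ i < k, β i = α i) :
    initialWord β k = initialWord α k :=
  List.map_congr_left fun i hi => h i (List.mem_range.1 hi)

theorem exists_codingMap (hF : IsStructureSystem F) :
    ∃ π : (ℕ → Fin m) → Eucl n, ∀ α k, π α ∈ F (initialWord α k) := by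
  have key : ∀ α : ℕ → Fin m, (⋂ k, F (initialWord α k)).Nonempty := fun α =>
    IsCompact.nonempty_iInter_of_sequence_nonempty_isCompact_isClosed _
      (fun k => by
        rw [initialWord_succ, hF.eq_iUnion (initialWord α k)]
        exact subset_iUnion (fun i => F (initialWord α k ++ [i])) (α k))
      (fun k => hF.nonempty _) (hF.isCompact _) (fun k => (hF.isCompact _).isClosed)
  choose π hπ using key
  exact ⟨π, fun α k => mem_iInter.1 (hπ α) k⟩

theorem tendsto_wordRatio_initialWord (S : IFSS n m) (α : ℕ → Fin m) :
    Tendsto (fun k => S.wordRatio (initialWord α k)) atTop (𝓝 0) := by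
  have : NeZero m := ⟨by rintro rfl; exact (α 0).elim0⟩
  obtain ⟨q, hq0, hq1, hq⟩ := S.exists_ratio_le
  refine squeeze_zero (fun k => (S.wordRatio_pos _).le)
    (fun k => (S.wordRatio_le_pow hq _).trans_eq (by rw [length_initialWord]))
    (tendsto_pow_atTop_nhds_zero_of_lt_one hq0.le hq1)

/-- Codes agreeing in `k` letters map into the same piece, whose diameter tends to zero. Continuity
gives the measurability needed for the pushforward. -/
theorem continuous_codingMap
    (hdist : ∀ w, ∀ x ∈ F w, ∀ y ∈ F w, dist x y ≤ C * S.wordRatio w)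
    {π : (ℕ → Fin m) → Eucl n} (hπ : ∀ α k, π α ∈ F (initialWord α k)) : Continuous π := by
  refine continuous_iff_continuousAt.2 fun α => Metric.tendsto_nhds.2 fun ε hε => ?_
  have h0 := (tendsto_wordRatio_initialWord S α).const_mul C
  rw [mul_zero] at h0
  obtain ⟨k, hk⟩ := (h0.eventually (gt_mem_nhds hε)).exists
  have hnhds : ∀ᶠ β in 𝓝 α, ∀ i ∈ Finset.range k, β i = α i :=
    (Finset.eventually_all _).2 fun i _ =>
      ((isOpen_discrete {α i}).preimage
        (continuous_apply (A := fun _ : ℕ => Fin m) i)).mem_nhds (mem_singleton (α i))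
  filter_upwards [hnhds] with β hβ
  refine (hdist (initialWord α k) _ ?_ _ (hπ α k)).trans_lt hk
  rw [← initialWord_congr fun i hi => hβ i (Finset.mem_range.2 hi)]
  exact hπ β k

theorem IFSS.wordRatio_initialWord_rpow (S : IFSS n m) (s : ℝ) (α : ℕ → Fin m) (k : ℕ) :
    S.wordRatio (initialWord α k) ^ s = ∏ i ∈ Finset.range k, S.ratio (α i) ^ s := by
  induction k with
  | zero => simp [initialWord, S.wordRatio_nil]
  | succ k ih =>
    rw [initialWord_succ, S.wordRatio_append_singleton,
      Real.mul_rpow (S.wordRatio_pos _).le (S.ratio_pos _).le, ih, Finset.prod_range_succ]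

/-- The Bernoulli measure on the infinite words that gives the cylinder of `w` the mass `c_w ^ s`. -/
theorem exists_bernoulliMeasure (hs : ∑ i, S.ratio i ^ s = 1) :
    ∃ ν : Measure (ℕ → Fin m), IsProbabilityMeasure ν ∧ ∀ α k,
      ν {β | ∀ i < k, β i = α i} = ENNReal.ofReal (S.wordRatio (initialWord α k) ^ s) := by
  have hpos : ∀ i, 0 ≤ S.ratio i ^ s := fun i => Real.rpow_nonneg (S.ratio_pos i).le s
  let P : PMF (Fin m) := PMF.ofFintype (fun i => ENNReal.ofReal (S.ratio i ^ s)) (by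
    rw [← ENNReal.ofReal_sum_of_nonneg fun i _ => hpos i, hs, ENNReal.ofReal_one])
  refine ⟨Measure.infinitePi fun _ => P.toMeasure, inferInstance, fun α k => ?_⟩
  have hset : {β : ℕ → Fin m | ∀ i < k, β i = α i}
      = ((Finset.range k : Finset ℕ) : Set ℕ).pi fun i => {α i} := by
    ext β; simp [Set.mem_pi]
  rw [hset, Measure.infinitePi_pi _ fun i _ => measurableSet_singleton _,
    S.wordRatio_initialWord_rpow, ENNReal.ofReal_prod_of_nonneg fun i _ => hpos _]
  refine Finset.prod_congr rfl fun i _ => ?_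
  rw [PMF.toMeasure_apply_singleton _ _ (measurableSet_singleton _)]
  rfl

theorem SeparationCondition.le_dist_codingMap (hsep : SeparationCondition S F ε₀)
    {π : (ℕ → Fin m) → Eucl n} (hπ : ∀ α k, π α ∈ F (initialWord α k)) {α β : ℕ → Fin m} {k : ℕ}
    (h : ∀ i < k, β i = α i) (hne : β k ≠ α k) :
    ε₀ * S.wordRatio (initialWord α k) ≤ dist (π α) (π β) := by
  have htake : ∀ γ : ℕ → Fin m, (initialWord γ (k + 1)).take k = initialWord γ k := fun γ => by
    rw [initialWord_succ, List.take_left' (length_initialWord γ k)]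
  -- Length `k + 1` is needed for the differing letter, at index `k`, to be part of the words.
  have := hsep (initialWord α (k + 1)) (initialWord β (k + 1)) k
    (by simp [length_initialWord]) (by simp [length_initialWord])
    (by rw [htake, htake, initialWord_congr h]) (by simpa [initialWord] using hne.symm)
  rw [htake] at this
  exact this.trans (setDist_le_dist (hπ α _) (hπ β _))

/-- Separation gives a mass distribution on `F []` of exponent `s`. -/
theorem exists_massDistribution (hF : IsStructureSystem F) (hs0 : 0 ≤ s)
    (hs : ∑ i, S.ratio i ^ s = 1)
    (hdist : ∀ w, ∀ x ∈ F w, ∀ y ∈ F w, dist x y ≤ C * S.wordRatio w)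
    (hε : 0 < ε₀) (hsep : SeparationCondition S F ε₀) :
    ∃ μ : Measure (Eucl n), μ (F []) = 1 ∧
      ∀ U : Set (Eucl n), ENNReal.ofReal (min 1 (ε₀ ^ s)) * μ U ≤ Metric.ediam U ^ s := by
  obtain ⟨π, hπ⟩ := exists_codingMap hF
  obtain ⟨ν, hν, hcyl⟩ := exists_bernoulliMeasure (S := S) hs
  have hmeas : Measurable π := (continuous_codingMap hdist hπ).measurable
  have hF0 : (ν.map π) (F []) = 1 := by
    rw [Measure.map_apply hmeas (hF.isCompact []).measurableSet,
      show π ⁻¹' F [] = univ from eq_univ_of_forall fun α => hπ α 0, measure_univ]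
  refine ⟨ν.map π, hF0, fun U => ?_⟩
  -- The closure has the same diameter and a measurable preimage.
  have hcl : ENNReal.ofReal (min 1 (ε₀ ^ s)) * ν (π ⁻¹' closure U)
      ≤ Metric.ediam (closure U) ^ s := by
    by_cases hsplit : ∃ k, ∃ α ∈ π ⁻¹' closure U, ∃ β ∈ π ⁻¹' closure U, β k ≠ α k
    · classical
      obtain ⟨α, hα, β, hβ, hne⟩ := Nat.find_spec hsplit
      -- The first index at which any two codes in the preimage differ, so the whole preimage lies
      -- in one cylinder of length `k`.
      set k := Nat.find hsplit with hk
      have hagree : ∀ γ ∈ π ⁻¹' closure U, ∀ i < k, γ i = α i := fun γ hγ i hi => by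
        have := Nat.find_min hsplit hi
        push Not at this
        exact this α hα γ hγ
      have hc := S.wordRatio_pos (initialWord α k)
      have hd := hsep.le_dist_codingMap hπ (hagree β hβ) hne
      calc ENNReal.ofReal (min 1 (ε₀ ^ s)) * ν (π ⁻¹' closure U)
          ≤ ENNReal.ofReal (ε₀ ^ s) * ν {γ | ∀ i < k, γ i = α i} := by
            gcongr
            · exact min_le_right _ _
            · exact hagree
        _ = ENNReal.ofReal (ε₀ * S.wordRatio (initialWord α k)) ^ s := by
            rw [hcyl, ← ENNReal.ofReal_mul (by positivity), ← Real.mul_rpow hε.le hc.le,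
              ENNReal.ofReal_rpow_of_nonneg (by positivity) hs0]
        _ ≤ edist (π α) (π β) ^ s := by rw [edist_dist]; gcongr
        _ ≤ Metric.ediam (closure U) ^ s := by
            gcongr; exact Metric.edist_le_ediam_of_mem hα hβ
    · push Not at hsplit
      -- The preimage has at most one code. For `s = 0` it may carry full mass, but the right side
      -- is then 1, which is why the constant is capped at 1; for `s > 0` it is null.
      rcases hs0.eq_or_lt with rfl | hspos
      · rw [ENNReal.rpow_zero]
        refine mul_le_one' ?_ prob_le_one
        rw [← ENNReal.ofReal_one]
        exact ENNReal.ofReal_le_ofReal (min_le_left _ _)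
      · suffices h : ν (π ⁻¹' closure U) = 0 by simp [h]
        rcases (π ⁻¹' closure U).eq_empty_or_nonempty with he | ⟨α, hα⟩
        · simp [he]
        have hlim : Tendsto (fun k => ENNReal.ofReal (S.wordRatio (initialWord α k) ^ s)) atTop
            (𝓝 0) := by
          have := (tendsto_wordRatio_initialWord S α).rpow_const (p := s) (Or.inr hspos.le)
          rw [Real.zero_rpow hspos.ne'] at this
          simpa using ENNReal.tendsto_ofReal this
        refine le_antisymm (ge_of_tendsto' hlim fun k => ?_) bot_le
        rw [← hcyl]
        exact measure_mono fun β hβ i _ => hsplit i α hα β hβ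
  calc ENNReal.ofReal (min 1 (ε₀ ^ s)) * (ν.map π) U
      ≤ ENNReal.ofReal (min 1 (ε₀ ^ s)) * (ν.map π) (closure U) := by
        gcongr; exact subset_closure
    _ ≤ Metric.ediam U ^ s := by
        rw [Measure.map_apply hmeas isClosed_closure.measurableSet, ← Metric.ediam_closure U]
        exact hcl

end Coding

/-! ### From mass and covers to measure and box dimension. -/

section Dimension

variable {n : ℕ} {A : Set (Eucl n)} {s κ K C : ℝ} {μ : Measure (Eucl n)}

/-- The mass distribution principle. -/
theorem hausdorffMeasure_pos_of_mass (hκ : 0 < κ) (hA : μ A = 1)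
    (hμ : ∀ U : Set (Eucl n), ENNReal.ofReal κ * μ U ≤ Metric.ediam U ^ s) : 0 < μH[s] A := by
  have h := Measure.le_hausdorffMeasure s (ENNReal.ofReal κ • μ) 1 one_pos fun U _ => by
    simpa using hμ U
  refine lt_of_lt_of_le ?_ (h A)
  simpa [hA] using hκ

/-- Mass and covers pin `N(r) r ^ s` between `κ` and `K`. Taking logarithms and dividing by `-log
r`, which tends to infinity, squeezes the quotient to `s`. -/
theorem hasBoxDim_of_mass_of_cover (hs0 : 0 ≤ s) (hκ : 0 < κ) (hA : μ A = 1)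
    (hμ : ∀ U : Set (Eucl n), ENNReal.ofReal κ * μ U ≤ Metric.ediam U ^ s)
    (hC : 0 < C)
    (hcov : ∀ r, 0 < r → r < C → ∃ (N : ℕ) (U : Fin N → Set (Eucl n)),
      (∀ j, Metric.ediam (U j) ≤ ENNReal.ofReal r) ∧ A ⊆ ⋃ j, U j ∧ (N : ℝ) * r ^ s ≤ K) :
    HasBoxDim A s := by
  have bounds : ∀ r, 0 < r → r < C →
      κ ≤ coverNumber A r * r ^ s ∧ coverNumber A r * r ^ s ≤ K := by
    intro r hr hrC
    obtain ⟨N, U, hU, hAU, hN⟩ := hcov r hr hrC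
    refine ⟨?_, le_trans ?_ hN⟩
    · obtain ⟨V, hV, hAV⟩ := Nat.sInf_mem
        (s := {N : ℕ | ∃ U : Fin N → Set (Eucl n),
          (∀ j, Metric.ediam (U j) ≤ ENNReal.ofReal r) ∧ A ⊆ ⋃ j, U j}) ⟨N, U, hU, hAU⟩
      change Fin (coverNumber A r) → Set (Eucl n) at V
      have : ENNReal.ofReal κ ≤ ENNReal.ofReal (coverNumber A r * r ^ s) := calc
        ENNReal.ofReal κ = ENNReal.ofReal κ * μ A := by rw [hA, mul_one]
        _ ≤ ENNReal.ofReal κ * ∑ j, μ (V j) := by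
          gcongr; exact (measure_mono hAV).trans (measure_iUnion_fintype_le μ V)
        _ = ∑ j, ENNReal.ofReal κ * μ (V j) := Finset.mul_sum _ _ _
        _ ≤ ∑ _j : Fin (coverNumber A r), ENNReal.ofReal r ^ s := by
          refine Finset.sum_le_sum fun j _ => (hμ _).trans ?_
          gcongr
          exact hV j
        _ = ENNReal.ofReal (coverNumber A r * r ^ s) := by
          rw [ENNReal.ofReal_mul (Nat.cast_nonneg _), ENNReal.ofReal_natCast,
            ENNReal.ofReal_rpow_of_nonneg hr.le hs0]
          simp
      exact (ENNReal.ofReal_le_ofReal_iff (by positivity)).1 this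
    · gcongr
      exact Nat.sInf_le ⟨U, hU, hAU⟩
  have hlog : Tendsto (fun r : ℝ => -Real.log r) (𝓝[>] 0) atTop :=
    tendsto_neg_atBot_atTop.comp Real.tendsto_log_nhdsGT_zero
  have hlim : ∀ c : ℝ, Tendsto (fun r : ℝ => s + c / (-Real.log r)) (𝓝[>] 0) (𝓝 s) := fun c => by
    simpa using tendsto_const_nhds.add (hlog.const_div_atTop c)
  have hev : ∀ᶠ r : ℝ in 𝓝[>] 0, 0 < r ∧ r < C ∧ 0 < -Real.log r := by
    filter_upwards [self_mem_nhdsWithin, nhdsWithin_le_nhds (gt_mem_nhds hC),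
      hlog.eventually_gt_atTop 0] with r h1 h2 h3 using ⟨h1, h2, h3⟩
  have hlogmul : ∀ r : ℝ, 0 < r → r < C →
      0 < coverNumber A r * r ^ s ∧ Real.log (coverNumber A r * r ^ s)
        = Real.log (coverNumber A r) + s * Real.log r := by
    intro r hr hrC
    have h0 := hκ.trans_le (bounds r hr hrC).1
    have hrs : 0 < r ^ s := Real.rpow_pos_of_pos hr s
    refine ⟨h0, ?_⟩
    rw [Real.log_mul (pos_of_mul_pos_left h0 hrs.le).ne' hrs.ne', Real.log_rpow hr]
  refine tendsto_of_tendsto_of_tendsto_of_le_of_le' (hlim (Real.log κ)) (hlim (Real.log K)) ?_ ?_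
  · filter_upwards [hev] with r ⟨hr, hrC, hl⟩
    have h1 := Real.log_le_log hκ (bounds r hr hrC).1
    rw [(hlogmul r hr hrC).2] at h1
    rw [le_div_iff₀ hl, add_mul, div_mul_cancel₀ _ hl.ne']
    linarith
  · filter_upwards [hev] with r ⟨hr, hrC, hl⟩
    have h1 := Real.log_le_log (hlogmul r hr hrC).1 (bounds r hr hrC).2
    rw [(hlogmul r hr hrC).2] at h1
    rw [div_le_iff₀ hl, add_mul, div_mul_cancel₀ _ hl.ne']
    linarith

end Dimension

end QuasiSelfSimilar

theorem corollary3p2p5 {n m : ℕ} (S : QuasiSelfSimilar.IFSS n m)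
    (E : Set (QuasiSelfSimilar.Eucl n))
    (F : QuasiSelfSimilar.Word m → Set (QuasiSelfSimilar.Eucl n)) (δ : ℝ)
    (hF : QuasiSelfSimilar.IsQuasiSelfSimilar S E F δ)
    (hsep : ∃ ε₀ : ℝ, 0 < ε₀ ∧ QuasiSelfSimilar.SeparationCondition S F ε₀) :
    QuasiSelfSimilar.OpenSetCondition S F ∧
    ∃ s : ℝ, S.IsSimilarityDimension s ∧
      dimH (F []) = ENNReal.ofReal s ∧
      QuasiSelfSimilar.HasBoxDim (F []) s ∧
      0 < μH[s] (F []) ∧ μH[s] (F []) < ⊤ := by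
  obtain ⟨ε₀, hε, hsep⟩ := hsep
  have hFs := hF.structureSystem
  have := hFs.neZero
  obtain ⟨C, hC, hdist⟩ := hF.exists_dist_le
  obtain ⟨s, hs0, hs⟩ := S.exists_isSimilarityDimension
  obtain ⟨K, hcov⟩ := QuasiSelfSimilar.exists_cover hFs hs0 hs.1 hC hdist
  obtain ⟨μ, hμF, hμ⟩ := QuasiSelfSimilar.exists_massDistribution hFs hs0 hs.1 hdist hε hsep
  have hκ : 0 < min 1 (ε₀ ^ s) := lt_min one_pos (Real.rpow_pos_of_pos hε s)
  have hpos := QuasiSelfSimilar.hausdorffMeasure_pos_of_mass hκ hμF hμ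
  have hfin := QuasiSelfSimilar.hausdorffMeasure_lt_top_of_cover hs0 hC hcov
  refine ⟨hsep.openSetCondition hε hFs hC hdist, s, hs, ?_,
    QuasiSelfSimilar.hasBoxDim_of_mass_of_cover hs0 hκ hμF hμ hC hcov, hpos, hfin⟩
  lift s to NNReal using hs0
  rw [ENNReal.ofReal_coe_nnreal]
  exact dimH_of_hausdorffMeasure_ne_zero_ne_top hpos.ne' hfin.ne
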